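/- Let $\Bbbk$ be a commutative ring. For an abelian category $\mathcal A$, an object $H$ is *monoform* if $H\neq 0$ and for every non-zero subobject $N$ of $H$ the objects $H$ and $H/N$ have no common non-zero subobject. Two monoform objects are *atom equivalent* if they have a common non-zero subobject; the class of $H$ is written $\langle H\rangle$, and the classes form the *atom spectrum* $\mathrm{ASpec}(\mathcal A)$. The *atom support* of an object $M$ is the set of all $\langle H\rangle$ with $H$ monoform and $H\cong L/L'$ for some subobjects $L'\subseteq L\subseteq M$. The atom spectrum has the topology in which $\Phi$ is open iff every $\alpha\in\Phi$ equals $\langle H\rangle$ for some monoform $H$ whose atom support is contained in $\Phi$, and the specialization order ($x\leqslant y$ iff $x\in\overline{\{y\}}$). The set $\mathrm{Spec}\,\Bbbk$ of prime ideals is ordered by inclusion and has the topology whose open sets are the specialization-closed subsets, i.e. the subsets $U$ such that $\mathfrak p\in U$ and $\mathfrak p\subseteq\mathfrak q$ imply $\mathfrak q\in U$. (This is not the Zariski topology.) Disjoint unions of copies of $\mathrm{Spec}\,\Bbbk$ carry the disjoint union topology and order. 1. For all integers $n,m\geqslant 1$ and every prime ideal $\mathfrak p$ of $\Bbbk$,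 the module $\Bbbk/\mathfrak p$ over $\Bbbk\langle x_1,\ldots,x_n\rangle/(x_1,\ldots,x_n)^m$, on which all $x_i$ act as zero, is monoform, and the map $$\mathrm{Spec}\,\Bbbk\longrightarrow \mathrm{ASpec}\bigl(\mathrm{Mod}\,\Bbbk\langle x_1,\ldots,x_n\rangle/(x_1,\ldots,x_n)^m\bigr),\qquad \mathfrak p\longmapsto\langle \Bbbk/\mathfrak p\rangle,$$ is a homeomorphism and an order-isomorphism. 2. More generally, let $Q$ be a quiver with a finite vertex set $Q_0$ (and arbitrary sets of arrows), let $\Bbbk Q$ be its path algebra (the free $\Bbbk$-module on all paths, where $pq$ is the path "first $q$, then $p$" if the target of $q$ is the source of $p$, and $0$ otherwise), let $\mathfrak a\subseteq\Bbbk Q$ be the arrow ideal, i.e. the two-sided ideal generated by all arrows, and let $m\geqslant 1$. For $i\in Q_0$ and a prime ideal $\mathfrak p$ of $\Bbbk$ let $\tilde{\mathfrak p}(i)$ be the two-sided ideal of all $\xi\in\Bbbk Q$ whose coefficient to the trivial path $e_i$ lies in $\mathfrak p$; it contains $\mathfrak a^m$. Then every left $\Bbbk Q/\mathfrak a^m$-module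 $\Bbbk Q/\tilde{\mathfrak p}(i)$ is monoform, and the map $$\bigsqcup_{i\in Q_0}\mathrm{Spec}\,\Bbbk\longrightarrow \mathrm{ASpec}\bigl(\mathrm{Mod}\,\Bbbk Q/\mathfrak a^m\bigr),\qquad (i,\mathfrak p)\longmapsto\langle \Bbbk Q/\tilde{\mathfrak p}(i)\rangle,$$ is a homeomorphism and an order-isomorphism. -/

import Mathlib

open CategoryTheory CategoryTheory.Limits

universe u v w

noncomputable section

/-! ### Monoform objects and the atom spectrum of an abelian category -/

section Atoms

variable {C : Type u} [Category.{v} C] [Abelian C]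

/-- `H` is monoform: `H ≠ 0`, and for every non-zero subobject `N` of `H` the objects `H` and `H/N`
have no common non-zero subobject. -/
def IsMonoform (H : C) : Prop :=
  ¬ IsZero H ∧ ∀ (N : C) (i : N ⟶ H) [Mono i], ¬ IsZero N →
    ∀ (X : C) (f : X ⟶ H) (g : X ⟶ cokernel i) [Mono f] [Mono g], IsZero X

/-- `H` and `H'` have a common non-zero subobject. -/
def AtomEquiv (H H' : C) : Prop :=
  ∃ (X : C) (f : X ⟶ H) (g : X ⟶ H'), Mono f ∧ Mono g ∧ ¬ IsZero X

/-- Two non-zero subobjects of a monoform object have a common non-zero subobject. -/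
theorem IsMonoform.not_isZero_pullback {H X Y : C} (hH : IsMonoform H) (f : X ⟶ H) (g : Y ⟶ H)
    [Mono f] [Mono g] (hX : ¬ IsZero X) (hY : ¬ IsZero Y) : ¬ IsZero (pullback f g) := by
  intro h0
  apply hY
  have : Mono (g ≫ cokernel.π f) := by
    refine Preadditive.mono_of_cancel_zero _ fun {Z} t ht => ?_
    rw [← Category.assoc] at ht
    have h1 : Abelian.monoLift f (t ≫ g) ht ≫ f = t ≫ g := Abelian.monoLift_comp f _ ht
    have h2 := pullback.lift_snd (f := f) (g := g) _ _ h1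
    rw [← h2, h0.eq_of_src (pullback.snd f g) 0, comp_zero]
  exact hH.2 X f hX Y g (g ≫ cokernel.π f)

/-- A non-zero subobject of a monoform object is monoform. -/
theorem IsMonoform.of_mono {H K : C} (hH : IsMonoform H) (j : K ⟶ H) [Mono j]
    (hK : ¬ IsZero K) : IsMonoform K := by
  refine ⟨hK, fun N i _ hN X f g _ _ => ?_⟩
  have hp : IsPullback i (𝟙 N) j (i ≫ j) :=
    IsPullback.of_isLimit' ⟨by simp⟩ <| PullbackCone.IsLimit.mk _ (fun s => s.snd)
      (fun s => by
        rw [← cancel_mono j]; simpa using s.condition.symm)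
      (fun s => by simp) (fun s m _ h2 => by simpa using h2)
  have := Abelian.mono_cokernel_map_of_isPullback hp
  exact hH.2 N (i ≫ j) hN X (f ≫ j) (g ≫ cokernel.map i (i ≫ j) (𝟙 N) j hp.w)

variable (C) in
/-- Atom equivalence on the monoform objects of `C`. -/
def atomSetoid : Setoid {H : C // IsMonoform H} where
  r H H' := AtomEquiv H.1 H'.1
  iseqv :=
    { refl := fun H => ⟨H.1, 𝟙 _, 𝟙 _, inferInstance, inferInstance, H.2.1⟩
      symm := fun ⟨X, f, g, hf, hg, hX⟩ => ⟨X, g, f, hg, hf, hX⟩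
      trans := by
        rintro ⟨H₁, h₁⟩ ⟨H₂, h₂⟩ ⟨H₃, h₃⟩ ⟨X, f, g, _, _, hX⟩ ⟨Y, f', g', _, _, hY⟩
        exact ⟨pullback g f', pullback.fst g f' ≫ f, pullback.snd g f' ≫ g', mono_comp _ _,
          mono_comp _ _, h₂.not_isZero_pullback g f' hX hY⟩ }

variable (C) in
/-- The atom spectrum of `C`: the monoform objects modulo atom equivalence. -/
def ASpec : Type u := Quotient (atomSetoid C)

/-- The atom of a monoform object. -/
def atom (H : C) (hH : IsMonoform H) : ASpec C := Quotient.mk (atomSetoid C) ⟨H, hH⟩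

/-- The atom support of `M`: the atoms of the monoform objects that are isomorphic to `L/L'` for
some subobjects `L' ⊆ L ⊆ M`. -/
def ASupp (M : C) : Set (ASpec C) :=
  {α | ∃ (L' L : Subobject M) (hL : L' ≤ L) (H : C) (hH : IsMonoform H),
    Nonempty (H ≅ cokernel (Subobject.ofLE L' L hL)) ∧ atom H hH = α}

/-- The atom support of a subobject of `M` is contained in that of `M`. -/
theorem ASupp_subset_of_mono {K M : C} (j : K ⟶ M) [Mono j] : ASupp K ⊆ ASupp M := by
  rintro α ⟨L', L, hL, H, hH, ⟨e⟩, rfl⟩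
  have hmap : (Subobject.map j).obj L' ≤ (Subobject.map j).obj L :=
    (Subobject.map j).monotone hL
  refine ⟨_, _, hmap, H, hH, ⟨e ≪≫ ?_⟩, rfl⟩
  let e' : ∀ S : Subobject K, (S : C) ≅ ((Subobject.map j).obj S : C) := fun S =>
    (Subobject.underlyingIso (S.arrow ≫ j)).symm ≪≫ Subobject.isoOfEq _ _ (by
      rw [← Subobject.map_mk, Subobject.mk_arrow])
  have he' : ∀ S, (e' S).hom ≫ ((Subobject.map j).obj S).arrow = S.arrow ≫ j := fun S => by
    simp [e']
  refine cokernel.mapIso _ _ (e' L') (e' L) ?_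
  rw [← cancel_mono ((Subobject.map j).obj L).arrow]
  simp [he']

/-- The localization topology: `Φ` is open iff each atom in `Φ` is represented by a monoform object
whose atom support is contained in `Φ`. -/
instance : TopologicalSpace (ASpec C) where
  IsOpen Φ := ∀ α ∈ Φ, ∃ (H : C) (hH : IsMonoform H), atom H hH = α ∧ ASupp H ⊆ Φ
  isOpen_univ := by
    rintro ⟨H, hH⟩ _
    exact ⟨H, hH, rfl, Set.subset_univ _⟩
  isOpen_inter := by
    rintro Φ Ψ hΦ hΨ α ⟨h1, h2⟩
    obtain ⟨H₁, m₁, rfl, s₁⟩ := hΦ α h1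
    obtain ⟨H₂, m₂, e, s₂⟩ := hΨ _ h2
    obtain ⟨X, f, g, _, _, hX⟩ : AtomEquiv H₂ H₁ := Quotient.exact e
    have mX := m₁.of_mono g hX
    refine ⟨X, mX, Quotient.sound ⟨X, 𝟙 X, g, inferInstance, inferInstance, hX⟩, ?_⟩
    exact Set.subset_inter ((ASupp_subset_of_mono g).trans s₁) ((ASupp_subset_of_mono f).trans s₂)
  isOpen_sUnion := by
    rintro S hS α ⟨Φ, hΦ, hα⟩
    obtain ⟨H, hH, e, hs⟩ := hS Φ hΦ α hα
    exact ⟨H, hH, e, hs.trans (Set.subset_sUnion_of_mem hΦ)⟩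

/-- The specialization order: `x ≤ y` iff `x` lies in the closure of `{y}`. -/
instance : Preorder (ASpec C) := specializationPreorder (ASpec C)

theorem ASpec.le_iff {x y : ASpec C} : x ≤ y ↔ x ∈ closure {y} :=
  specializes_iff_mem_closure

end Atoms

/-! ### Path algebras -/

section PathAlgebra

/-- All paths in a quiver: a source, a target, and a path from the source to the target. -/
abbrev AllPaths (V : Type v) [Quiver.{w} V] : Type (max v w) :=
  Σ i j : V, Quiver.Path i j

/-- The underlying module of the path algebra: the free `k`-module on all paths. -/
def PathAlgebra (k : Type u) (V : Type v) [CommRing k] [Quiver.{w} V] : Type (max u v w) :=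
  AllPaths V →₀ k

namespace PathAlgebra

variable {k : Type u} {V : Type v} [CommRing k] [Quiver.{w} V]

instance : AddCommGroup (PathAlgebra k V) := inferInstanceAs (AddCommGroup (AllPaths V →₀ k))

instance : Module k (PathAlgebra k V) := inferInstanceAs (Module k (AllPaths V →₀ k))

/-- The basis element given by a path. -/
def ofPath (p : AllPaths V) : PathAlgebra k V := Finsupp.single p 1

/-- The trivial path `e_i`. -/
def trivialPath (i : V) : AllPaths V := ⟨i, i, Quiver.Path.nil⟩

/-- The path of length one given by an arrow. -/
def arrowPath {i j : V} (a : i ⟶ j) : AllPaths V := ⟨i, j, a.toPath⟩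

/-- The coefficient to a path. -/
def coeff (p : AllPaths V) : PathAlgebra k V →ₗ[k] k := Finsupp.lapply p

open Classical in
/-- The product `p q` of two paths: first `q`, then `p`, if the target of `q` is the source of `p`,
and zero otherwise. -/
def pathMul (p q : AllPaths V) : PathAlgebra k V :=
  if h : q.2.1 = p.1 then ofPath ⟨q.1, p.2.1, (q.2.2.cast rfl h).comp p.2.2⟩ else 0

/-- The bilinear extension of `pathMul`. -/
def mulLin : PathAlgebra k V →ₗ[k] PathAlgebra k V →ₗ[k] PathAlgebra k V :=
  Finsupp.linearCombination k fun p => Finsupp.linearCombination k fun q => pathMul p q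

theorem mulLin_ofPath (p q : AllPaths V) :
    mulLin (ofPath p) (ofPath q) = (pathMul p q : PathAlgebra k V) := by
  unfold mulLin ofPath
  erw [Finsupp.linearCombination_single, one_smul, Finsupp.linearCombination_single, one_smul]

theorem lin_ext {M : Type*} [AddCommMonoid M] [Module k M] {f g : PathAlgebra k V →ₗ[k] M}
    (h : ∀ p, f (ofPath p) = g (ofPath p)) : f = g :=
  Finsupp.lhom_ext' fun p => LinearMap.ext_ring (h p)

instance : Mul (PathAlgebra k V) := ⟨fun x y => mulLin x y⟩

theorem mul_eq (x y : PathAlgebra k V) : x * y = mulLin x y := rfl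

theorem ofPath_mul (p q : AllPaths V) :
    (ofPath p * ofPath q : PathAlgebra k V) = pathMul p q := mulLin_ofPath p q

theorem pathMul_comp {i j l : V} (q : Quiver.Path i j) (p : Quiver.Path j l) :
    (pathMul ⟨j, l, p⟩ ⟨i, j, q⟩ : PathAlgebra k V) = ofPath ⟨i, l, q.comp p⟩ := by
  simp [pathMul]

theorem pathMul_eq_zero {p q : AllPaths V} (h : q.2.1 ≠ p.1) :
    (pathMul p q : PathAlgebra k V) = 0 := dif_neg h

theorem ofPath_mul_assoc (p q r : AllPaths V) :
    (ofPath p * ofPath q * ofPath r : PathAlgebra k V) = ofPath p * (ofPath q * ofPath r) := by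
  obtain ⟨c, d, p⟩ := p
  obtain ⟨b, c', q⟩ := q
  obtain ⟨a, b', r⟩ := r
  rw [ofPath_mul, ofPath_mul]
  by_cases h1 : c' = c <;> by_cases h2 : b' = b
  · subst h1 h2
    simp only [pathMul_comp, ofPath_mul, Quiver.Path.comp_assoc]
  · subst h1
    rw [pathMul_comp, ofPath_mul, pathMul_eq_zero h2, pathMul_eq_zero h2, mul_eq, map_zero]
  · subst h2
    rw [pathMul_comp, ofPath_mul, pathMul_eq_zero h1, pathMul_eq_zero h1, mul_eq, map_zero]
    rfl
  · rw [pathMul_eq_zero h1, pathMul_eq_zero h2, mul_eq, mul_eq, map_zero, map_zero]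
    rfl

/-- The unit is the sum of the trivial paths; this needs finitely many vertices. -/
instance [Fintype V] : One (PathAlgebra k V) := ⟨∑ i, ofPath (trivialPath i)⟩

theorem one_eq [Fintype V] : (1 : PathAlgebra k V) = ∑ i, ofPath (trivialPath i) := rfl

instance [Fintype V] : Ring (PathAlgebra k V) :=
  { (inferInstance : AddCommGroup (PathAlgebra k V)),
    (inferInstance : Mul (PathAlgebra k V)), (inferInstance : One (PathAlgebra k V)) with
    left_distrib := fun x y z => map_add (mulLin x) y z
    right_distrib := fun x y z => by simp only [mul_eq, map_add, LinearMap.add_apply]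
    zero_mul := fun x => by simp only [mul_eq, map_zero, LinearMap.zero_apply]
    mul_zero := fun x => map_zero (mulLin x)
    mul_assoc := fun x y z => by
      have h1 : ∀ p q, mulLin (mulLin (ofPath p) (ofPath q)) =
          mulLin (ofPath p) ∘ₗ mulLin (k := k) (V := V) (ofPath q) := fun p q =>
        lin_ext fun r => ofPath_mul_assoc p q r
      have h2 : ∀ p, mulLin ∘ₗ mulLin (ofPath p) =
          LinearMap.llcomp k _ _ _ (mulLin (ofPath p)) ∘ₗ mulLin (k := k) (V := V) := fun p =>
        lin_ext fun q => h1 p q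
      have h3 : mulLin.flip z ∘ₗ mulLin.flip y =
          mulLin.flip (mulLin (k := k) (V := V) y z) :=
        lin_ext fun p => congrArg (fun f => f y z) (h2 p)
      exact congrArg (fun f => f x) h3
    one_mul := fun x => by
      have : mulLin (1 : PathAlgebra k V) = LinearMap.id := by
        refine lin_ext fun p => ?_
        obtain ⟨i, j, p⟩ := p
        rw [one_eq, map_sum, LinearMap.sum_apply, Finset.sum_eq_single j]
        · rw [mulLin_ofPath, trivialPath, pathMul_comp]; rfl
        · intro l _ hl
          rw [mulLin_ofPath, pathMul_eq_zero (Ne.symm hl)]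
        · simp
      exact congrArg (fun f => f x) this
    mul_one := fun x => by
      have : mulLin.flip (1 : PathAlgebra k V) = LinearMap.id := by
        refine lin_ext fun p => ?_
        obtain ⟨i, j, p⟩ := p
        rw [LinearMap.flip_apply, one_eq, map_sum, Finset.sum_eq_single i]
        · rw [mulLin_ofPath, trivialPath, pathMul_comp, Quiver.Path.nil_comp]; rfl
        · intro l _ hl
          rw [mulLin_ofPath, pathMul_eq_zero hl]
        · simp
      exact congrArg (fun f => f x) this }

instance [Fintype V] : Algebra k (PathAlgebra k V) :=
  Algebra.ofModule (fun r x y => by simp only [mul_eq, map_smul, LinearMap.smul_apply])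
    (fun r x y => by simp only [mul_eq, map_smul])

theorem coeff_ofPath (p q : AllPaths V) [Decidable (q = p)] :
    coeff p (ofPath q : PathAlgebra k V) = if q = p then 1 else 0 := by
  classical
  exact (Finsupp.single_apply).trans (by congr)

/-- The coefficient to `e_i` is multiplicative. -/
theorem coeff_trivialPath_mul (i : V) (x y : PathAlgebra k V) :
    coeff (trivialPath i) (x * y) = coeff (trivialPath i) x * coeff (trivialPath i) y := by
  classical
  have h1 : ∀ p q : AllPaths V, coeff (trivialPath i) (pathMul p q : PathAlgebra k V) =
      coeff (trivialPath i) (ofPath p : PathAlgebra k V) *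
        coeff (trivialPath i) (ofPath q : PathAlgebra k V) := by
    rintro ⟨b, c, p⟩ ⟨a, b', q⟩
    by_cases h : b' = b
    · subst h
      rw [pathMul_comp, coeff_ofPath, coeff_ofPath, coeff_ofPath, ite_zero_mul_ite_zero, one_mul]
      refine if_congr ⟨fun e => ?_, ?_⟩ rfl rfl
      · cases p with
        | cons p a =>
          have h1 := congrArg (fun t : AllPaths V => t.2.2.length) e
          simp [trivialPath] at h1
        | nil => cases q with
          | cons p a =>
            have h1 := congrArg (fun t : AllPaths V => t.2.2.length) e
            simp [trivialPath] at h1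
          | nil => exact ⟨e, e⟩
      · rintro ⟨e1, e2⟩
        cases p with
        | cons p a =>
          have h1 := congrArg (fun t : AllPaths V => t.2.2.length) e1
          simp [trivialPath] at h1
        | nil => exact e2
    · rw [pathMul_eq_zero h, map_zero, coeff_ofPath, coeff_ofPath, ite_zero_mul_ite_zero, if_neg]
      rintro ⟨e1, e2⟩
      exact h ((congrArg (fun t : AllPaths V => t.2.1) e2).trans
        (congrArg (fun t : AllPaths V => t.1) e1).symm)
  have h2 : ∀ p : AllPaths V, coeff (trivialPath i) ∘ₗ mulLin (ofPath p) =
      coeff (trivialPath i) (ofPath p : PathAlgebra k V) • coeff (k := k) (trivialPath i) :=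
    fun p => lin_ext fun q => by
      rw [LinearMap.comp_apply, mulLin_ofPath, h1]; rfl
  have h3 : coeff (trivialPath i) ∘ₗ mulLin.flip y =
      coeff (trivialPath i) y • coeff (k := k) (trivialPath i) :=
    lin_ext fun p => (congrArg (fun f => f y) (h2 p)).trans (mul_comm _ _)
  exact (congrArg (fun f => f x) h3).trans (mul_comm _ _)

variable (k V) in
/-- The arrow ideal: the two-sided ideal of `kQ` generated by all arrows. -/
def arrowIdeal [Fintype V] : Ideal (PathAlgebra k V) :=
  (TwoSidedIdeal.span
    {x : PathAlgebra k V | ∃ (i j : V) (a : i ⟶ j), x = ofPath (arrowPath a)}).asIdeal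

instance [Fintype V] : (arrowIdeal k V).IsTwoSided := by
  unfold arrowIdeal; infer_instance

/-- The ideal of the elements whose coefficient to `e_i` belongs to `p`. -/
def vertexIdeal [Fintype V] (p : Ideal k) (i : V) : Ideal (PathAlgebra k V) where
  carrier := {x | coeff (trivialPath i) x ∈ p}
  add_mem' := fun {x y} hx hy => by
    simp only [Set.mem_ofPred_eq, map_add] at *
    exact p.add_mem hx hy
  zero_mem' := by simp
  smul_mem' := fun c x hx => by
    simp only [Set.mem_ofPred_eq, smul_eq_mul, coeff_trivialPath_mul] at *
    exact p.mul_mem_left _ hx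

theorem mem_vertexIdeal [Fintype V] {p : Ideal k} {i : V} {x : PathAlgebra k V} :
    x ∈ vertexIdeal p i ↔ coeff (trivialPath i) x ∈ p := Iff.rfl

instance [Fintype V] (p : Ideal k) (i : V) : (vertexIdeal p i).IsTwoSided where
  mul_mem_of_left {a} b ha := by
    rw [mem_vertexIdeal, coeff_trivialPath_mul]
    exact p.mul_mem_right _ ha

theorem arrowIdeal_le_vertexIdeal [Fintype V] (p : Ideal k) (i : V) :
    arrowIdeal k V ≤ vertexIdeal p i := by
  classical
  have h : TwoSidedIdeal.span
      {x : PathAlgebra k V | ∃ (i j : V) (a : i ⟶ j), x = ofPath (arrowPath a)} ≤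
      (vertexIdeal p i).toTwoSided := by
    rw [TwoSidedIdeal.span_le]
    rintro _ ⟨j, l, a, rfl⟩
    rw [SetLike.mem_coe, Ideal.mem_toTwoSided, mem_vertexIdeal, coeff_ofPath, if_neg]
    · exact p.zero_mem
    · intro e
      have h1 := congrArg (fun t : AllPaths V => t.2.2.length) e
      simp [trivialPath, arrowPath] at h1
  intro x hx
  exact Ideal.mem_toTwoSided.1 (h (TwoSidedIdeal.mem_asIdeal.1 hx))

theorem isTorsionBySet_arrowIdeal_pow [Fintype V] {m : ℕ} (hm : 1 ≤ m) (p : Ideal k) (i : V) :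
    Module.IsTorsionBySet (PathAlgebra k V) (PathAlgebra k V ⧸ vertexIdeal p i)
      ((arrowIdeal k V ^ m : Ideal (PathAlgebra k V)) : Set (PathAlgebra k V)) := by
  rintro x ⟨a, ha⟩
  obtain ⟨y, rfl⟩ := Ideal.Quotient.mk_surjective x
  obtain ⟨m, rfl⟩ := Nat.exists_eq_add_of_le' hm
  refine Ideal.Quotient.eq_zero_iff_mem.2 (Ideal.mul_mem_right y _ ?_)
  refine arrowIdeal_le_vertexIdeal p i ?_
  rw [Submodule.pow_succ] at ha
  exact Ideal.mul_le_right ha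

/-- The module `kQ/p̃(i)` over `kQ/𝔞^m`, where `𝔞` is the arrow ideal and `p̃(i)` consists of the
elements whose coefficient to `e_i` lies in `p`. -/
def vertexModule [Fintype V] (m : ℕ) (hm : 1 ≤ m) (p : Ideal k) (i : V) :
    ModuleCat.{max u v w} (PathAlgebra k V ⧸ arrowIdeal k V ^ m) :=
  letI := (isTorsionBySet_arrowIdeal_pow hm p i).module
  ModuleCat.of (PathAlgebra k V ⧸ arrowIdeal k V ^ m) (PathAlgebra k V ⧸ vertexIdeal p i)

end PathAlgebra

end PathAlgebra

/-! ### Truncated free algebras -/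

section FreeAlgebra

variable (k : Type u) [CommRing k] (n : ℕ)

/-- The two-sided ideal `(x_1, …, x_n)` of the free algebra `k⟨x_1, …, x_n⟩`. -/
def varIdeal : Ideal (FreeAlgebra k (Fin n)) :=
  (TwoSidedIdeal.span (Set.range (FreeAlgebra.ι k : Fin n → FreeAlgebra k (Fin n)))).asIdeal

instance : (varIdeal k n).IsTwoSided := by
  unfold varIdeal; infer_instance

theorem algebraMapInv_eq_zero_of_mem {x : FreeAlgebra k (Fin n)} (hx : x ∈ varIdeal k n) :
    FreeAlgebra.algebraMapInv x = 0 := by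
  have h : TwoSidedIdeal.span (Set.range (FreeAlgebra.ι k : Fin n → FreeAlgebra k (Fin n))) ≤
      TwoSidedIdeal.ker
        (FreeAlgebra.algebraMapInv : FreeAlgebra k (Fin n) →ₐ[k] k).toRingHom := by
    rw [TwoSidedIdeal.span_le]
    rintro _ ⟨i, rfl⟩
    rw [SetLike.mem_coe, TwoSidedIdeal.mem_ker]
    simp [FreeAlgebra.algebraMapInv]
  exact (TwoSidedIdeal.mem_ker _).1 (h (TwoSidedIdeal.mem_asIdeal.1 hx))

/-- The `k`-algebra map `k⟨x_1, …, x_n⟩/(x_1, …, x_n)^m → k` sending every variable to zero. -/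
def truncatedAugmentation {m : ℕ} (hm : 1 ≤ m) :
    FreeAlgebra k (Fin n) ⧸ varIdeal k n ^ m →+* k :=
  Ideal.Quotient.lift _ (FreeAlgebra.algebraMapInv : FreeAlgebra k (Fin n) →ₐ[k] k).toRingHom
    (fun a ha => by
      obtain ⟨m, rfl⟩ := Nat.exists_eq_add_of_le' hm
      rw [Submodule.pow_succ] at ha
      exact algebraMapInv_eq_zero_of_mem k n (Ideal.mul_le_right ha))

/-- The module `k/p` over `k⟨x_1, …, x_n⟩/(x_1, …, x_n)^m` on which all variables act as zero. -/
def residueModule (m : ℕ) (hm : 1 ≤ m) (p : Ideal k) :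
    ModuleCat.{u} (FreeAlgebra k (Fin n) ⧸ varIdeal k n ^ m) :=
  letI := Module.compHom (k ⧸ p) (truncatedAugmentation k n hm)
  ModuleCat.of (FreeAlgebra k (Fin n) ⧸ varIdeal k n ^ m) (k ⧸ p)

end FreeAlgebra

end

/-! Both algebras have the form `R = A/J^m`, with `J` the ideal of the variables or of the arrows,
and carry finitely many surjections `ε i : R → k` (one for the free algebra, one per vertex for the
path algebra) whose common kernel is the nilpotent image of `J`. For a prime `p`, the preimage `P`
of `p` under `ε i` has quotient `k/p`, a commutative domain, and the modules in question are cyclic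
with annihilator `P`.

In such a module every non-zero element has annihilator `P`. This makes it monoform
(`IsCyclicWith.isMonoform`), and its atom is recognized by the elements with annihilator `P`
(`IsCyclicWith.atomEquiv_iff`), so distinct ideals give distinct atoms.

Every atom arises in this way (`IsMonoform.exists_hasAnnihilator_comap`). Since `J` acts
nilpotently, a monoform module has a non-zero element killed by `J`, and an idempotent-like element
`e i` moves it to some `y ≠ 0` killed by the kernel of `ε i`. On `R ∙ y` the action factors through
`k`, so scalars act by endomorphisms, and these are zero or injective by monoformity. Hence the
annihilator of `y` comes from a prime.

For the topology, the atoms in the support of the module with annihilator `P` are those of the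
modules with annihilator `Q ⊇ P` (`mem_ASupp_iff_of_cyclic`). Every representative of its atom
contains a copy of this module, so this support is the smallest possible one, and open sets of atoms
are exactly the upper sets. The specialization order then follows from the homeomorphism. -/

noncomputable section

/-! ### Monoform modules over a ring and their cyclic submodules -/

section MonoformModules

variable {R : Type u} [Ring R]

/-- A left ideal `P` with commutative quotient `R/P` an integral domain. -/
structure IsCommPrime (P : Ideal R) : Prop where
  one_notMem : (1 : R) ∉ P
  mem_or_mem : ∀ r s : R, r * s ∈ P → r ∈ P ∨ s ∈ P
  comm_mem : ∀ r s : R, r * s - s * r ∈ P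

/-- Since `P` contains all commutators, it is a two-sided ideal. -/
theorem IsCommPrime.mul_mem_iff {P : Ideal R} (hP : IsCommPrime P) (r s : R) :
    r * s ∈ P ↔ r ∈ P ∨ s ∈ P := by
  refine ⟨hP.mem_or_mem r s, ?_⟩
  rintro (h | h)
  · have := P.add_mem (hP.comm_mem r s) (P.mul_mem_left s h)
    rwa [sub_add_cancel] at this
  · exact P.mul_mem_left r h

/-- The annihilator of `x` is `P`. -/
def HasAnnihilator {M : Type*} [AddCommGroup M] [Module R M] (P : Ideal R) (x : M) : Prop :=
  ∀ r : R, r • x = 0 ↔ r ∈ P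

/-- `M` is generated by an element with annihilator `P`. -/
def IsCyclicWith (M : Type*) [AddCommGroup M] [Module R M] (P : Ideal R) : Prop :=
  ∃ g : M, (∀ x : M, ∃ r : R, r • g = x) ∧ HasAnnihilator P g

/-- If `x = s • g` is non-zero then `s ∉ P`, and `r * s ∈ P` forces `r ∈ P`. -/
theorem IsCyclicWith.hasAnnihilator {M : Type*} [AddCommGroup M] [Module R M] {P : Ideal R}
    (hP : IsCommPrime P) (hM : IsCyclicWith M P) {x : M} (hx : x ≠ 0) : HasAnnihilator P x := by
  obtain ⟨g, hg, ha⟩ := hM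
  obtain ⟨s, rfl⟩ := hg x
  intro r
  rw [← mul_smul, ha, hP.mul_mem_iff]
  exact or_iff_left fun h => hx ((ha s).2 h)

theorem HasAnnihilator.ne_zero {M : Type*} [AddCommGroup M] [Module R M] {P : Ideal R}
    (hP : IsCommPrime P) {g : M} (ha : HasAnnihilator P g) : g ≠ 0 := by
  rintro rfl
  exact hP.one_notMem ((ha 1).1 (smul_zero 1))

/-- A linear map on a cyclic module is determined by an element with larger annihilator. -/
theorem exists_linearMap_of_cyclic {M N : Type*} [AddCommGroup M] [Module R M] [AddCommGroup N]
    [Module R N] {g : M} (hg : ∀ x : M, ∃ r : R, r • g = x) {y : N}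
    (hy : ∀ r : R, r • g = 0 → r • y = 0) : ∃ φ : M →ₗ[R] N, ∀ r : R, φ (r • g) = r • y := by
  have key : ∀ a b : R, a • g = b • g → a • y = b • y := fun a b h => by
    rw [← sub_eq_zero, ← sub_smul] at h ⊢
    exact hy _ h
  choose c hc using hg
  refine ⟨⟨⟨fun x => c x • y, fun x x' => ?_⟩, fun r x => ?_⟩, fun r => key _ _ (hc _)⟩
  · rw [← add_smul]
    exact key _ _ (by rw [hc, add_smul, hc, hc])
  · rw [RingHom.id_apply, ← mul_smul]
    exact key _ _ (by rw [hc, mul_smul, hc])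

/-! ### Elements and morphisms in the category of modules -/

theorem exists_ne_zero_of_not_isZero {M : ModuleCat.{u} R} (hM : ¬ IsZero M) : ∃ x : M, x ≠ 0 := by
  rw [ModuleCat.isZero_iff_subsingleton, not_subsingleton_iff_nontrivial] at hM
  exact exists_ne 0

theorem not_isZero_of_ne_zero {M : ModuleCat.{u} R} {x : M} (hx : x ≠ 0) : ¬ IsZero M := by
  rw [ModuleCat.isZero_iff_subsingleton]
  exact fun h => hx (Subsingleton.elim _ _)

theorem hom_injective_of_mono {M N : ModuleCat.{u} R} (f : M ⟶ N) [Mono f] :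
    Function.Injective f :=
  (ModuleCat.mono_iff_injective f).1 inferInstance

theorem hom_eq_zero_iff_of_mono {M N : ModuleCat.{u} R} (f : M ⟶ N) [Mono f] {x : M} :
    f x = 0 ↔ x = 0 :=
  map_eq_zero_iff f.hom (hom_injective_of_mono f)

theorem hom_surjective_of_epi {M N : ModuleCat.{u} R} (f : M ⟶ N) [Epi f] :
    Function.Surjective f :=
  (ModuleCat.epi_iff_surjective f).1 inferInstance

theorem HasAnnihilator.map_mono {M N : ModuleCat.{u} R} {P : Ideal R} {x : M}
    (hx : HasAnnihilator P x) (f : M ⟶ N) [Mono f] : HasAnnihilator P (f x) := fun r => by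
  rw [← hx r, ← map_smul, hom_eq_zero_iff_of_mono f]

theorem cokernel_π_eq_zero_iff {M N : ModuleCat.{u} R} (i : M ⟶ N) (y : N) :
    cokernel.π i y = 0 ↔ ∃ x, i x = y := by
  refine ⟨(ShortComplex.moduleCat_exact_iff _).1 (ShortComplex.exact_cokernel i) y, ?_⟩
  rintro ⟨x, rfl⟩
  rw [← ConcreteCategory.comp_apply, cokernel.condition]
  rfl

/-- A module generated by an element whose annihilator is prime with commutative quotient is
monoform. -/
theorem IsCyclicWith.isMonoform {M : ModuleCat.{u} R} {P : Ideal R} (hP : IsCommPrime P)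
    (hM : IsCyclicWith M P) : IsMonoform M := by
  obtain ⟨g, hg, ha⟩ := id hM
  refine ⟨not_isZero_of_ne_zero (HasAnnihilator.ne_zero hP ha), fun N i _ hN X f h _ _ => ?_⟩
  by_contra hX
  obtain ⟨x, hx⟩ := exists_ne_zero_of_not_isZero hX
  obtain ⟨n, hn⟩ := exists_ne_zero_of_not_isZero hN
  obtain ⟨a, han⟩ := hg (i n)
  obtain ⟨y, hy⟩ := hom_surjective_of_epi (cokernel.π i) (h x)
  obtain ⟨b, rfl⟩ := hg y
  have hfx : f x ≠ 0 := (hom_eq_zero_iff_of_mono f).not.2 hx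
  have haP : a ∉ P := fun h0 => hn <| hom_injective_of_mono i <| by
    rw [map_zero, ← han, ha]
    exact h0
  -- The scalar `a` kills `h x`, the class of `b • g`: commutators kill `g`, so `a • b • g = b • a •
  -- g`, which is the image of `b • n`. As `f` and `h` are injective, `a` kills `f x` too, whose
  -- annihilator is `P`.
  refine haP ((hM.hasAnnihilator hP hfx a).1 ?_)
  rw [← map_smul, hom_eq_zero_iff_of_mono f,
    ← hom_eq_zero_iff_of_mono h, map_smul, ← hy, ← map_smul,
    cokernel_π_eq_zero_iff]
  refine ⟨b • n, ?_⟩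
  rw [map_smul, ← han, ← mul_smul, ← mul_smul, ← sub_eq_zero, ← sub_smul, ha]
  exact hP.comm_mem b a

/-- A non-zero endomorphism of a monoform object is a monomorphism. -/
theorem IsMonoform.mono_of_ne_zero {C : Type u} [Category.{v} C] [Abelian C] {H : C}
    (hH : IsMonoform H) {f : H ⟶ H} (hf : f ≠ 0) : Mono f := by
  by_contra hm
  have hk : ¬ IsZero (kernel f) := fun h0 =>
    hm (Preadditive.mono_of_kernel_zero (h0.eq_of_src _ _))
  -- The coimage is `H / kernel f`, and it also embeds into `H`; monoformity makes it zero.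
  have h0 := hH.2 (kernel f) (kernel.ι f) hk (Abelian.coimage f) (Abelian.factorThruCoimage f)
    (𝟙 _)
  apply hf
  rw [← Abelian.coimage.fac f, h0.eq_of_src (Abelian.factorThruCoimage f) 0, comp_zero]

theorem IsCyclicWith.exists_mono {M H : ModuleCat.{u} R} {P : Ideal R} (hM : IsCyclicWith M P)
    {x : H} (hx : HasAnnihilator P x) : ∃ f : M ⟶ H, Mono f := by
  obtain ⟨g, hg, ha⟩ := hM
  obtain ⟨φ, hφ⟩ := exists_linearMap_of_cyclic hg (y := x) fun r hr => (hx r).2 ((ha r).1 hr)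
  refine ⟨ModuleCat.ofHom φ, (ModuleCat.mono_iff_injective _).2 ?_⟩
  refine (injective_iff_map_eq_zero φ).2 fun y hy => ?_
  obtain ⟨r, rfl⟩ := hg y
  rw [hφ, hx] at hy
  exact (ha r).2 hy

theorem IsCyclicWith.exists_epi {M N : ModuleCat.{u} R} {P Q : Ideal R} (hM : IsCyclicWith M P)
    (hN : IsCyclicWith N Q) (hPQ : P ≤ Q) : ∃ f : M ⟶ N, Epi f := by
  obtain ⟨g, hg, ha⟩ := hM
  obtain ⟨g', hg', ha'⟩ := hN
  obtain ⟨φ, hφ⟩ := exists_linearMap_of_cyclic hg (y := g') fun r hr =>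
    (ha' r).2 (hPQ ((ha r).1 hr))
  refine ⟨ModuleCat.ofHom φ, (ModuleCat.epi_iff_surjective _).2 fun y => ?_⟩
  obtain ⟨r, rfl⟩ := hg' y
  exact ⟨r • g, hφ r⟩

/-- `H` is atom equivalent to the cyclic module with annihilator `P` iff it contains an element with
annihilator `P`. -/
theorem IsCyclicWith.atomEquiv_iff {M H : ModuleCat.{u} R} {P : Ideal R} (hP : IsCommPrime P)
    (hM : IsCyclicWith M P) : AtomEquiv H M ↔ ∃ x : H, HasAnnihilator P x := by
  constructor
  · rintro ⟨X, f, g, _, _, hX⟩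
    obtain ⟨x, hx⟩ := exists_ne_zero_of_not_isZero hX
    have hgx : g x ≠ 0 := (hom_eq_zero_iff_of_mono g).not.2 hx
    refine ⟨f x, HasAnnihilator.map_mono (fun r => ?_) f⟩
    rw [← hM.hasAnnihilator hP hgx r, ← map_smul, hom_eq_zero_iff_of_mono g]
  · rintro ⟨x, hx⟩
    obtain ⟨f, _⟩ := hM.exists_mono hx
    exact ⟨M, f, 𝟙 M, inferInstance, inferInstance, (hM.isMonoform hP).1⟩

/-! ### Atoms, atom supports and the parametrization by cyclic modules -/

theorem atom_eq_atom_iff {C : Type u} [Category.{v} C] [Abelian C] {H K : C} {hH : IsMonoform H}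
    {hK : IsMonoform K} : atom H hH = atom K hK ↔ AtomEquiv H K :=
  ⟨fun h => Quotient.exact h, fun h => Quotient.sound h⟩

/-- The atom of a monoform quotient of `M` belongs to the atom support of `M`. -/
theorem atom_mem_ASupp_of_epi {C : Type u} [Category.{v} C] [Abelian C] {M H : C}
    (hH : IsMonoform H) (f : M ⟶ H) [Epi f] : atom H hH ∈ ASupp M := by
  refine ⟨kernelSubobject f, ⊤, le_top, H, hH, ⟨?_⟩, rfl⟩
  let e₁ : cokernel (Subobject.ofLE (kernelSubobject f) ⊤ le_top) ≅ cokernel (kernel.ι f) :=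
    cokernel.mapIso _ _ (kernelSubobjectIso f) (asIso (⊤ : Subobject M).arrow) (by simp)
  let e₂ : cokernel (kernel.ι f) ≅ H :=
    (colimit.isColimit _).coconePointUniqueUpToIso
      (Abelian.epiIsCokernelOfKernel _ (kernelIsKernel f))
  exact (e₁ ≪≫ e₂).symm

/-- A scalar annihilating `M` annihilates the subquotients of `M`. -/
theorem smul_eq_zero_of_atom_mem_ASupp {M : ModuleCat.{u} R} {α : ASpec (ModuleCat.{u} R)}
    (hα : α ∈ ASupp M) {r : R} (hr : ∀ x : M, r • x = 0) :
    ∃ (H : ModuleCat.{u} R) (hH : IsMonoform H), atom H hH = α ∧ ∀ x : H, r • x = 0 := by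
  obtain ⟨L', L, hL, H, hH, ⟨e⟩, rfl⟩ := hα
  refine ⟨H, hH, rfl, fun x => ?_⟩
  apply hom_injective_of_mono e.hom
  obtain ⟨y, hy⟩ := hom_surjective_of_epi (cokernel.π (Subobject.ofLE L' L hL)) (e.hom x)
  have : r • y = 0 := hom_injective_of_mono L.arrow (by rw [map_smul, hr, map_zero])
  rw [map_smul, ← hy, ← map_smul, this, map_zero, map_zero]

variable {T : Type*} [Preorder T] {P : T → Ideal R} {S : T → ModuleCat.{u} R}

/-- If the cyclic modules `S t` exhaust the atoms, then the atom support of `S s` consists of the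
atoms of the `S t` with `s ≤ t`. -/
theorem mem_ASupp_iff_of_cyclic (hP : ∀ t, IsCommPrime (P t)) (hle : ∀ s t, P s ≤ P t ↔ s ≤ t)
    (hS : ∀ t, IsCyclicWith (S t) (P t)) (s t : T) :
    atom (S t) ((hS t).isMonoform (hP t)) ∈ ASupp (S s) ↔ s ≤ t := by
  constructor
  · refine fun h => (hle s t).1 fun r hr => ?_
    -- Every `r ∈ P s` kills all of `S s`, hence some representative of the atom of `S t`; that
    -- representative contains an element with annihilator `P t`.
    obtain ⟨H, hH, e, h0⟩ := smul_eq_zero_of_atom_mem_ASupp h (r := r) fun x => by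
      by_cases hx : x = 0
      · rw [hx, smul_zero]
      · exact ((hS s).hasAnnihilator (hP s) hx r).2 hr
    obtain ⟨x, hx⟩ := ((hS t).atomEquiv_iff (hP t)).1 (atom_eq_atom_iff.1 e)
    exact (hx r).1 (h0 x)
  · intro h
    obtain ⟨f, _⟩ := (hS s).exists_epi (hS t) ((hle s t).2 h)
    exact atom_mem_ASupp_of_epi _ f

/-- If every monoform module contains an element with annihilator `P t` for some `t`, then the
cyclic modules `S t` parametrize the atom spectrum. -/
theorem exists_isHomeomorph_atom [TopologicalSpace T] [Topology.IsUpperSet T]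
    (hP : ∀ t, IsCommPrime (P t)) (hinj : Function.Injective P) (hle : ∀ s t, P s ≤ P t ↔ s ≤ t)
    (hS : ∀ t, IsCyclicWith (S t) (P t))
    (hex : ∀ H : ModuleCat.{u} R, IsMonoform H → ∃ t, ∃ x : H, HasAnnihilator (P t) x) :
    ∃ hH : ∀ t, IsMonoform (S t), ∃ f : T → ASpec (ModuleCat.{u} R),
      (∀ t, f t = atom (S t) (hH t)) ∧ IsHomeomorph f ∧
        ∃ e : T ≃o ASpec (ModuleCat.{u} R), ⇑e = f := by
  have hH : ∀ t, IsMonoform (S t) := fun t => (hS t).isMonoform (hP t)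
  let f : T → ASpec (ModuleCat.{u} R) := fun t => atom (S t) (hH t)
  have hmem : ∀ s t, f t ∈ ASupp (S s) ↔ s ≤ t := mem_ASupp_iff_of_cyclic hP hle hS
  have hbij : Function.Bijective f := by
    constructor
    · intro s t h
      obtain ⟨x, hx⟩ := ((hS t).atomEquiv_iff (hP t)).1 (atom_eq_atom_iff.1 h)
      have := (hS s).hasAnnihilator (hP s) (HasAnnihilator.ne_zero (hP t) hx)
      exact hinj (Ideal.ext fun r => (this r).symm.trans (hx r))
    · rintro ⟨H, h⟩
      obtain ⟨t, x, hx⟩ := hex H h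
      exact ⟨t, (atom_eq_atom_iff.2 (((hS t).atomEquiv_iff (hP t)).2 ⟨x, hx⟩)).symm⟩
  have hopen : ∀ Φ : Set (ASpec (ModuleCat.{u} R)), IsOpen Φ ↔ IsOpen (f ⁻¹' Φ) := by
    intro Φ
    rw [Topology.IsUpperSet.isOpen_iff_isUpperSet (s := f ⁻¹' Φ)]
    constructor
    -- Whatever representative `H` witnesses openness, it contains a copy of `S s`, so its support
    -- contains that of `S s`.
    · intro hΦ s t hst hs
      obtain ⟨H, h, e, hsub⟩ := hΦ _ hs
      obtain ⟨x, hx⟩ := ((hS s).atomEquiv_iff (hP s)).1 (atom_eq_atom_iff.1 e)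
      obtain ⟨j, _⟩ := (hS s).exists_mono hx
      exact hsub (ASupp_subset_of_mono j ((hmem s t).2 hst))
    -- Conversely `S s` itself serves as the representative.
    · intro hΦ α hα
      obtain ⟨s, rfl⟩ := hbij.2 α
      refine ⟨S s, hH s, rfl, fun β hβ => ?_⟩
      obtain ⟨t, rfl⟩ := hbij.2 β
      exact hΦ ((hmem s t).1 hβ) hα
  have hhom : IsHomeomorph f :=
    ⟨⟨fun Φ hΦ => (hopen Φ).1 hΦ⟩,
      fun U hU => (hopen _).2 (by rwa [hbij.1.preimage_image]), hbij⟩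
  refine ⟨hH, f, fun _ => rfl, hhom, ⟨Equiv.ofBijective f hbij, fun {s t} => ?_⟩, rfl⟩
  -- A homeomorphism preserves specialization, and in the upper set topology the closure of `{t}`
  -- consists of all `s ≤ t`.
  have h1 : f s ≤ f t ↔ s ∈ closure {t} := by
    rw [ASpec.le_iff, ← specializes_iff_mem_closure, ← specializes_iff_mem_closure]
    exact (hhom.homeomorph f).isInducing.specializes_iff
  rw [Topology.IsUpperSet.closure_singleton] at h1
  exact h1

end MonoformModules

/-! ### Monoform modules over a ring with nilpotent kernel onto a product of copies of `k` -/

section Augmentations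

/-- If a power of an ideal annihilates a non-zero module, then some non-zero element is annihilated
by the ideal. -/
theorem exists_ne_zero_smul_eq_zero {A M : Type*} [Ring A] [AddCommGroup M] [Module A M]
    (J : Ideal A) (m : ℕ) {x : M} (hx : x ≠ 0) (hJ : ∀ a ∈ J ^ m, a • x = 0) :
    ∃ y : M, y ≠ 0 ∧ ∀ a ∈ J, a • y = 0 := by
  induction m generalizing x with
  | zero => exact absurd (by rw [← one_smul A x, hJ 1 (by rw [Submodule.pow_zero]; exact Submodule.one_le.1 le_rfl)]) hx
  | succ m ih =>
    by_cases h : ∀ a ∈ J, a • x = 0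
    · exact ⟨x, hx, h⟩
    · push Not at h
      obtain ⟨b, hb, hbx⟩ := h
      -- As `J ^ m * J` kills `x`, the smaller power `J ^ m` kills `b • x`.
      refine ih hbx fun a ha => ?_
      rw [← mul_smul]
      exact hJ _ (by rw [Submodule.pow_succ]; exact Ideal.mul_mem_mul ha hb)

variable {R : Type u} [Ring R] {k : Type w} [CommRing k]

/-- The quotient by the preimage embeds into the commutative domain `k/p`. -/
theorem isCommPrime_comap (ε : R →+* k) {p : Ideal k} (hp : p.IsPrime) :
    IsCommPrime (p.comap ε) where
  one_notMem h := hp.ne_top <| (Ideal.eq_top_iff_one p).2 <| by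
    rwa [Ideal.mem_comap, map_one] at h
  mem_or_mem r s h := hp.mem_or_mem <| by rwa [Ideal.mem_comap, map_mul] at h
  comm_mem r s := by
    rw [Ideal.mem_comap, map_sub, map_mul, map_mul, mul_comm, sub_self]
    exact p.zero_mem

/-- In a monoform module, the annihilator of a non-zero element annihilated by the kernel of a
surjection onto a commutative ring is the preimage of a prime ideal. -/
theorem IsMonoform.exists_prime_of_smul_eq_zero {H : ModuleCat.{u} R} (hH : IsMonoform H)
    {ε : R →+* k} (hε : Function.Surjective ε) {y : H} (hy : y ≠ 0)
    (hker : ∀ r, ε r = 0 → r • y = 0) :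
    ∃ p : Ideal k, p.IsPrime ∧ HasAnnihilator (p.comap ε) y := by
  have key : ∀ a b : R, ε a = ε b → a • y = b • y := fun a b h => by
    rw [← sub_eq_zero, ← sub_smul]
    exact hker _ (by rw [map_sub, h, sub_self])
  -- This is the annihilator of `y` for the induced action of `k`; by `key` the condition does not
  -- depend on the lift `r` of `c`.
  let p : Ideal k :=
    { carrier := {c | ∀ r, ε r = c → r • y = 0}
      zero_mem' := hker
      add_mem' := by
        intro c d hc hd r hr
        obtain ⟨a, rfl⟩ := hε c
        obtain ⟨b, rfl⟩ := hε d
        rw [key r (a + b) (by rw [hr, map_add]), add_smul, hc a rfl, hd b rfl, add_zero]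
      smul_mem' := by
        intro c d hd r hr
        obtain ⟨a, rfl⟩ := hε c
        obtain ⟨b, rfl⟩ := hε d
        rw [key r (a * b) (by rw [hr, map_mul, smul_eq_mul]), mul_smul, hd b rfl, smul_zero] }
  have hann : ∀ r, r • y = 0 ↔ ε r ∈ p :=
    fun r => ⟨fun h s hs => by rw [key s r hs, h], fun h => h r rfl⟩
  refine ⟨p, ⟨?_, ?_⟩, hann⟩
  · rw [Ideal.ne_top_iff_one]
    intro h
    rw [← map_one ε, ← hann, one_smul] at h
    exact hy h
  · intro c d hcd
    obtain ⟨a, rfl⟩ := hε c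
    obtain ⟨b, rfl⟩ := hε d
    rw [← map_mul, ← hann] at hcd
    rw [← hann, ← hann]
    by_contra! hne
    let N : Submodule R H := R ∙ y
    let g : N := ⟨y, Submodule.mem_span_singleton_self y⟩
    have hg : ∀ x : N, ∃ r : R, r • g = x := fun ⟨x, hx⟩ => by
      obtain ⟨r, rfl⟩ := Submodule.mem_span_singleton.1 hx
      exact ⟨r, rfl⟩
    have hval : ∀ r : R, r • g = 0 ↔ r • y = 0 := fun r => by
      rw [← Submodule.coe_eq_zero]; rfl
    have hN : IsMonoform (ModuleCat.of R N) := by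
      have : Mono (ModuleCat.ofHom N.subtype) :=
        (ModuleCat.mono_iff_injective _).2 N.injective_subtype
      exact hH.of_mono (ModuleCat.ofHom N.subtype)
        (not_isZero_of_ne_zero (x := (g : ModuleCat.of R N)) fun h => hy (congrArg Subtype.val h))
    -- `R` acts on `R ∙ y` through the commutative ring `k`, so multiplication by `a` becomes a
    -- linear endomorphism `φ`. It is non-zero because `a • y ≠ 0`.
    have hcomm : ∀ r : R, r • a • g = a • r • g := fun r => Subtype.ext <| by
      change r • a • y = a • r • y
      rw [← mul_smul, ← mul_smul]
      exact key _ _ (by rw [map_mul, map_mul, mul_comm])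
    obtain ⟨φ, hφ⟩ := exists_linearMap_of_cyclic hg (y := a • g) fun r hr => by
      rw [hcomm, hr, smul_zero]
    have hφ0 : ModuleCat.ofHom φ ≠ 0 := fun h => by
      have h1 : φ ((1 : R) • g) = 0 := congrArg (fun ψ => ψ.hom ((1 : R) • g)) h
      rw [hφ, one_smul, hval] at h1
      exact hne.1 h1
    have := hN.mono_of_ne_zero hφ0
    have hinj : Function.Injective φ := hom_injective_of_mono (ModuleCat.ofHom φ)
    -- Injectivity of `φ` turns `a • b • g = 0` into `b • g = 0`.
    refine hne.2 ((hval b).1 (hinj ?_))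
    rw [map_zero, hφ, hcomm, ← mul_smul]
    exact (hval _).2 hcd

/-- If `A → R` is a ring homomorphism killing `J ^ m`, and `R` has finitely many surjections `ε i`
onto `k` with dual elements `e i` such that the common kernel of the `ε i` comes from `J`, then
every monoform module contains an element whose annihilator is the preimage of a prime ideal. -/
theorem IsMonoform.exists_hasAnnihilator_comap {A : Type*} [Ring A] (π : A →+* R)
    (J : Ideal A) (m : ℕ) (hJm : ∀ a ∈ J ^ m, π a = 0) {ι : Type*} [Fintype ι] [DecidableEq ι]
    (ε : ι → R →+* k) (hε : ∀ i, Function.Surjective (ε i)) (e : ι → R)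
    (he : ∀ i j, ε i (e j) = if i = j then 1 else 0)
    (hJ : ∀ r, (∀ i, ε i r = 0) → ∃ a ∈ J, π a = r) {H : ModuleCat.{u} R} (hH : IsMonoform H) :
    ∃ (i : ι) (p : PrimeSpectrum k), ∃ x : H, HasAnnihilator (p.asIdeal.comap (ε i)) x := by
  obtain ⟨x₀, hx₀⟩ := exists_ne_zero_of_not_isZero hH.1
  let _ := Module.compHom H π
  obtain ⟨x, hx, hJx⟩ := exists_ne_zero_smul_eq_zero J m hx₀ fun a ha => by
    change π a • x₀ = 0
    rw [hJm a ha, zero_smul]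
  have hann : ∀ r, (∀ i, ε i r = 0) → r • x = 0 := fun r hr => by
    obtain ⟨a, ha, rfl⟩ := hJ r hr
    exact hJx a ha
  obtain ⟨i, hi⟩ : ∃ i, e i • x ≠ 0 := by
    -- Every `ε i` kills `1 - ∑ i, e i`, so `x` is the sum of the `e i • x`, which cannot all
    -- vanish.
    by_contra! h
    have h1 := hann (1 - ∑ i, e i) fun i => by simp [he]
    rw [sub_smul, one_smul, Finset.sum_smul, Finset.sum_eq_zero fun i _ => h i, sub_zero] at h1
    exact hx h1
  -- If `ε i r = 0`, then `r * e i` lies in the kernel of every `ε j`: for `j = i` because of `r`,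
  -- otherwise because of `e i`.
  obtain ⟨p, hp, hpx⟩ := hH.exists_prime_of_smul_eq_zero (hε i) hi fun r hr => by
    rw [← mul_smul]
    refine hann _ fun j => ?_
    rw [map_mul, he]
    split_ifs with h
    · rw [h, hr, zero_mul]
    · rw [mul_zero]
  exact ⟨i, ⟨p, hp⟩, _, hpx⟩

end Augmentations

/-! ### Truncated free algebras -/

section TruncatedFreeAlgebra

variable (k : Type u) [CommRing k] (n : ℕ)

theorem mem_varIdeal_of_algebraMapInv_eq_zero {x : FreeAlgebra k (Fin n)}
    (hx : FreeAlgebra.algebraMapInv x = (0 : k)) : x ∈ varIdeal k n := by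
  suffices h : ∀ x : FreeAlgebra k (Fin n),
      x - algebraMap k _ (FreeAlgebra.algebraMapInv x) ∈ varIdeal k n by
    simpa [hx] using h x
  intro x
  induction x using FreeAlgebra.induction with
  | grade0 r => simp
  | grade1 i =>
    have : FreeAlgebra.ι k i ∈ varIdeal k n :=
      TwoSidedIdeal.mem_asIdeal.2 (TwoSidedIdeal.subset_span ⟨i, rfl⟩)
    simpa [FreeAlgebra.algebraMapInv] using this
  | mul a b ha hb =>
    rw [map_mul, map_mul]
    -- With `ε` the augmentation, `ab - ε(a)ε(b) = a(b - ε(b)) + (a - ε(a))ε(b)`.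
    have := (varIdeal k n).add_mem ((varIdeal k n).mul_mem_left a hb)
      (Ideal.mul_mem_right (algebraMap k _ (FreeAlgebra.algebraMapInv b)) _ ha)
    convert this using 1
    noncomm_ring
  | add a b ha hb =>
    rw [map_add, map_add, add_sub_add_comm]
    exact (varIdeal k n).add_mem ha hb

theorem truncatedAugmentation_mk {m : ℕ} (hm : 1 ≤ m) (a : FreeAlgebra k (Fin n)) :
    truncatedAugmentation k n hm (Ideal.Quotient.mk _ a) = FreeAlgebra.algebraMapInv a := rfl

theorem truncatedAugmentation_surjective {m : ℕ} (hm : 1 ≤ m) :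
    Function.Surjective (truncatedAugmentation k n hm) := fun c =>
  ⟨Ideal.Quotient.mk _ (algebraMap k _ c), by
    rw [truncatedAugmentation_mk]
    exact FreeAlgebra.algebraMap_leftInverse c⟩

theorem residueModule_isCyclicWith {m : ℕ} (hm : 1 ≤ m) (p : Ideal k) :
    IsCyclicWith (residueModule k n m hm p) (p.comap (truncatedAugmentation k n hm)) := by
  refine ⟨(Ideal.Quotient.mk p 1 : k ⧸ p), fun x => ?_, fun r => ?_⟩
  · obtain ⟨c, rfl⟩ := Ideal.Quotient.mk_surjective (I := p) x
    obtain ⟨r, rfl⟩ := truncatedAugmentation_surjective k n hm c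
    refine ⟨r, ?_⟩
    change Ideal.Quotient.mk p (truncatedAugmentation k n hm r * 1) = _
    rw [mul_one]
  · change Ideal.Quotient.mk p (truncatedAugmentation k n hm r * 1) = 0 ↔ _
    rw [mul_one, Ideal.Quotient.eq_zero_iff_mem, Ideal.mem_comap]

theorem exists_isHomeomorph_residueModule (m : ℕ) (hm : 1 ≤ m) :
    ∃ hH : ∀ p : PrimeSpectrum k, IsMonoform (residueModule k n m hm p.asIdeal),
      ∃ f : Topology.WithUpperSet (PrimeSpectrum k) →
          ASpec (ModuleCat.{u} (FreeAlgebra k (Fin n) ⧸ varIdeal k n ^ m)),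
        (∀ p : PrimeSpectrum k, f (Topology.WithUpperSet.toUpperSet p) =
          atom (residueModule k n m hm p.asIdeal) (hH p)) ∧
        IsHomeomorph f ∧
        ∃ e : Topology.WithUpperSet (PrimeSpectrum k) ≃o
          ASpec (ModuleCat.{u} (FreeAlgebra k (Fin n) ⧸ varIdeal k n ^ m)), ⇑e = f := by
  have hsurj := truncatedAugmentation_surjective k n hm
  refine exists_isHomeomorph_atom (T := Topology.WithUpperSet (PrimeSpectrum k))
    (P := fun p => (Topology.WithUpperSet.ofUpperSet p).asIdeal.comap
      (truncatedAugmentation k n hm))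
    (S := fun p => residueModule k n m hm (Topology.WithUpperSet.ofUpperSet p).asIdeal)
    (fun p => isCommPrime_comap _ (Topology.WithUpperSet.ofUpperSet p).isPrime)
    (fun p q h => PrimeSpectrum.ext (Ideal.comap_injective_of_surjective _ hsurj h))
    (fun p q => Ideal.comap_le_comap_iff_of_surjective _ hsurj _ _)
    (fun p => residueModule_isCyclicWith k n hm _) fun H hH => ?_
  -- There is a single augmentation here, with dual element `1`.
  obtain ⟨-, p, hp⟩ := hH.exists_hasAnnihilator_comap (Ideal.Quotient.mk (varIdeal k n ^ m))
    (varIdeal k n) m (fun a ha => Ideal.Quotient.eq_zero_iff_mem.2 ha)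
    (fun _ : Unit => truncatedAugmentation k n hm) (fun _ => hsurj) (fun _ => 1) (by simp)
    fun r hr => by
      obtain ⟨a, rfl⟩ := Ideal.Quotient.mk_surjective r
      exact ⟨a, mem_varIdeal_of_algebraMapInv_eq_zero k n (hr ()), rfl⟩
  exact ⟨Topology.WithUpperSet.toUpperSet p, hp⟩

end TruncatedFreeAlgebra

/-! ### Truncated path algebras -/

/-- A disjoint union of spaces with the upper set topology has the upper set topology. -/
instance Topology.IsUpperSet.sigma {ι : Type*} {α : ι → Type*} [∀ i, TopologicalSpace (α i)]
    [∀ i, Preorder (α i)] [∀ i, Topology.IsUpperSet (α i)] : Topology.IsUpperSet (Sigma α) := by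
  refine ⟨TopologicalSpace.ext_iff.2 fun s => ?_⟩
  rw [isOpen_sigma_iff]
  simp only [Topology.IsUpperSet.isOpen_iff_isUpperSet]
  constructor
  · rintro h _ _ ⟨i, a, b, hab⟩ ha
    exact h i hab ha
  · intro h i a b hab ha
    exact h (Sigma.LE.fiber i a b hab) ha

section TruncatedPathAlgebra

namespace PathAlgebra

variable {k : Type u} {V : Type v} [CommRing k] [Quiver.{w} V]

theorem coeff_trivialPath_ofPath_trivialPath [DecidableEq V] (i j : V) :
    coeff (trivialPath i) (ofPath (trivialPath j) : PathAlgebra k V) = if i = j then 1 else 0 := by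
  classical
  rw [coeff_ofPath]
  refine if_congr ⟨fun h => (congrArg Sigma.fst h).symm, fun h => h ▸ rfl⟩ rfl rfl

variable [Fintype V]

/-- A path of positive length is its last arrow times the rest, the last arrow being the left
factor. -/
theorem ofPath_cons_mem_arrowIdeal {i j l : V} (q : Quiver.Path i j) (a : j ⟶ l) :
    (ofPath ⟨i, l, q.cons a⟩ : PathAlgebra k V) ∈ arrowIdeal k V := by
  have h1 : (ofPath (arrowPath a) : PathAlgebra k V) ∈ arrowIdeal k V :=
    TwoSidedIdeal.mem_asIdeal.2 (TwoSidedIdeal.subset_span ⟨j, l, a, rfl⟩)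
  have h2 : (ofPath ⟨i, l, q.cons a⟩ : PathAlgebra k V) =
      ofPath (arrowPath a) * ofPath ⟨i, j, q⟩ := by
    rw [ofPath_mul, arrowPath, pathMul_comp]; rfl
  rw [h2]
  exact Ideal.mul_mem_right _ _ h1

theorem smul_mem_arrowIdeal (c : k) {x : PathAlgebra k V} (hx : x ∈ arrowIdeal k V) :
    c • x ∈ arrowIdeal k V := by
  rw [Algebra.smul_def]
  exact Ideal.mul_mem_left _ _ hx

/-- An element without constant coefficients belongs to the arrow ideal. -/
theorem mem_arrowIdeal_of_coeff_eq_zero {x : PathAlgebra k V}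
    (hx : ∀ i, coeff (trivialPath i) x = 0) : x ∈ arrowIdeal k V := by
  have hsum : x = ∑ p ∈ Finsupp.support (M := k) x, coeff p x • (ofPath p : PathAlgebra k V) := by
    refine (Finsupp.sum_single (x : AllPaths V →₀ k)).symm.trans ?_
    refine Finset.sum_congr rfl fun p _ => ?_
    exact (Finsupp.smul_single_one p _).symm
  rw [hsum]
  refine Ideal.sum_mem _ fun p _ => ?_
  obtain ⟨i, j, p⟩ := p
  cases p with
  | nil =>
    rw [show coeff ⟨i, i, Quiver.Path.nil⟩ x = 0 from hx i, zero_smul]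
    exact Ideal.zero_mem _
  | cons q a => exact smul_mem_arrowIdeal _ (ofPath_cons_mem_arrowIdeal q a)

theorem coeff_trivialPath_one (i : V) : coeff (trivialPath i) (1 : PathAlgebra k V) = 1 := by
  classical
  simp [one_eq, coeff_trivialPath_ofPath_trivialPath]

/-- The coefficient to `e_i` as a ring homomorphism. -/
def vertexHom (i : V) : PathAlgebra k V →+* k where
  toFun := coeff (trivialPath i)
  map_one' := coeff_trivialPath_one i
  map_mul' := coeff_trivialPath_mul i
  map_zero' := map_zero _
  map_add' := map_add _

/-- The ring homomorphism `kQ/𝔞^m → k` given by the coefficient to `e_i`. -/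
def truncatedVertexHom {m : ℕ} (hm : 1 ≤ m) (i : V) :
    PathAlgebra k V ⧸ arrowIdeal k V ^ m →+* k :=
  Ideal.Quotient.lift _ (vertexHom i) fun a ha => by
    obtain ⟨m, rfl⟩ := Nat.exists_eq_add_of_le' hm
    rw [Submodule.pow_succ] at ha
    -- Membership in `vertexIdeal ⊥ i` says that the coefficient to `e_i` is zero.
    exact (Submodule.mem_bot k).1 (arrowIdeal_le_vertexIdeal ⊥ i (Ideal.mul_le_right ha))

theorem truncatedVertexHom_mk {m : ℕ} (hm : 1 ≤ m) (i : V) (x : PathAlgebra k V) :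
    truncatedVertexHom hm i (Ideal.Quotient.mk _ x) = coeff (trivialPath i) x := rfl

theorem truncatedVertexHom_surjective {m : ℕ} (hm : 1 ≤ m) (i : V) :
    Function.Surjective (truncatedVertexHom (k := k) hm i) := fun c => by
  classical
  refine ⟨Ideal.Quotient.mk _ (c • ofPath (trivialPath i)), ?_⟩
  rw [truncatedVertexHom_mk, map_smul, coeff_trivialPath_ofPath_trivialPath, if_pos rfl,
    smul_eq_mul, mul_one]

theorem vertexModule_isCyclicWith {m : ℕ} (hm : 1 ≤ m) (p : Ideal k) (i : V) :
    IsCyclicWith (vertexModule m hm p i) (p.comap (truncatedVertexHom hm i)) := by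
  let g : vertexModule m hm p i :=
    (Ideal.Quotient.mk (vertexIdeal p i) 1 : PathAlgebra k V ⧸ vertexIdeal p i)
  have hsmul : ∀ r : PathAlgebra k V, Ideal.Quotient.mk (arrowIdeal k V ^ m) r • g =
      (Ideal.Quotient.mk (vertexIdeal p i) r : PathAlgebra k V ⧸ vertexIdeal p i) := fun r => by
    change Ideal.Quotient.mk (vertexIdeal p i) (r * 1) = _
    rw [mul_one]
  refine ⟨g, fun x => ?_, fun r => ?_⟩
  · obtain ⟨r, rfl⟩ := Ideal.Quotient.mk_surjective (I := vertexIdeal p i) x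
    exact ⟨Ideal.Quotient.mk _ r, hsmul r⟩
  · obtain ⟨r, rfl⟩ := Ideal.Quotient.mk_surjective r
    rw [hsmul]
    exact Ideal.Quotient.eq_zero_iff_mem

/-- The trivial path at `j` separates vertices: for `i ≠ j` it lies in the left-hand ideal, but its
coefficient `1` at `j` keeps it out of the right-hand one, as `q` is proper. This is why different
copies of the spectrum are incomparable. -/
theorem comap_truncatedVertexHom_le_iff {m : ℕ} (hm : 1 ≤ m) (i j : V) (p q : Ideal k)
    (hq : q ≠ ⊤) : p.comap (truncatedVertexHom hm i) ≤ q.comap (truncatedVertexHom hm j) ↔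
      i = j ∧ p ≤ q := by
  classical
  constructor
  · intro h
    have hij : i = j := by
      by_contra hij
      have h1 := h (x := Ideal.Quotient.mk _ (ofPath (trivialPath j))) (by
        rw [Ideal.mem_comap, truncatedVertexHom_mk, coeff_trivialPath_ofPath_trivialPath,
          if_neg hij]
        exact p.zero_mem)
      rw [Ideal.mem_comap, truncatedVertexHom_mk, coeff_trivialPath_ofPath_trivialPath,
        if_pos rfl] at h1
      exact hq ((Ideal.eq_top_iff_one q).2 h1)
    subst hij
    exact ⟨rfl, (Ideal.comap_le_comap_iff_of_surjective _
      (truncatedVertexHom_surjective hm i) _ _).1 h⟩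
  · rintro ⟨rfl, h⟩
    exact Ideal.comap_mono h

theorem exists_isHomeomorph_vertexModule (m : ℕ) (hm : 1 ≤ m) :
    ∃ hH : ∀ (i : V) (p : PrimeSpectrum k), IsMonoform (vertexModule (V := V) m hm p.asIdeal i),
      ∃ f : (Σ _ : V, Topology.WithUpperSet (PrimeSpectrum k)) →
          ASpec (ModuleCat.{max u v w} (PathAlgebra k V ⧸ arrowIdeal k V ^ m)),
        (∀ (i : V) (p : PrimeSpectrum k), f ⟨i, Topology.WithUpperSet.toUpperSet p⟩ =
          atom (vertexModule m hm p.asIdeal i) (hH i p)) ∧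
        IsHomeomorph f ∧
        ∃ e : (Σ _ : V, Topology.WithUpperSet (PrimeSpectrum k)) ≃o
          ASpec (ModuleCat.{max u v w} (PathAlgebra k V ⧸ arrowIdeal k V ^ m)), ⇑e = f := by
  classical
  let I : (Σ _ : V, Topology.WithUpperSet (PrimeSpectrum k)) → PrimeSpectrum k :=
    fun t => Topology.WithUpperSet.ofUpperSet t.2
  have hiff : ∀ s t, (I s).asIdeal.comap (truncatedVertexHom hm s.1) ≤
      (I t).asIdeal.comap (truncatedVertexHom hm t.1) ↔ s.1 = t.1 ∧ I s ≤ I t :=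
    fun s t => comap_truncatedVertexHom_le_iff hm _ _ _ _ (I t).isPrime.ne_top
  obtain ⟨hH, f, hf, hrest⟩ := exists_isHomeomorph_atom
    (T := Σ _ : V, Topology.WithUpperSet (PrimeSpectrum k))
    (P := fun t => (I t).asIdeal.comap (truncatedVertexHom hm t.1))
    (S := fun t => vertexModule m hm (I t).asIdeal t.1)
    (fun t => isCommPrime_comap _ (I t).isPrime)
    (fun s t h => by
      obtain ⟨h1, h2⟩ := (hiff s t).1 h.le
      obtain ⟨-, h3⟩ := (hiff t s).1 h.ge
      exact Sigma.ext h1 (heq_of_eq (le_antisymm (α := PrimeSpectrum k) h2 h3)))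
    (fun s t => by
      rw [hiff]
      constructor
      · obtain ⟨i, p⟩ := s
        obtain ⟨j, q⟩ := t
        rintro ⟨rfl, h⟩
        exact Sigma.LE.fiber _ _ _ h
      · rintro ⟨i, p, q, h⟩
        exact ⟨rfl, h⟩)
    (fun t => vertexModule_isCyclicWith hm _ _) fun H hH => by
      obtain ⟨i, p, hp⟩ := hH.exists_hasAnnihilator_comap
        (Ideal.Quotient.mk (arrowIdeal k V ^ m)) (arrowIdeal k V) m
        (fun a ha => Ideal.Quotient.eq_zero_iff_mem.2 ha) (truncatedVertexHom hm)
        (truncatedVertexHom_surjective hm)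
        (fun i => Ideal.Quotient.mk _ (ofPath (trivialPath i)))
        (fun i j => coeff_trivialPath_ofPath_trivialPath i j)
        fun r hr => by
          obtain ⟨a, rfl⟩ := Ideal.Quotient.mk_surjective r
          exact ⟨a, mem_arrowIdeal_of_coeff_eq_zero hr, rfl⟩
      exact ⟨⟨i, Topology.WithUpperSet.toUpperSet p⟩, hp⟩
  exact ⟨fun i p => hH ⟨i, Topology.WithUpperSet.toUpperSet p⟩, f, fun i p => hf _, hrest⟩

end PathAlgebra

end TruncatedPathAlgebra

end

theorem mainTheorem10 :
    (∀ (k : Type u) [CommRing k] (n m : ℕ) (_ : 1 ≤ n) (hm : 1 ≤ m),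
      ∃ hH : ∀ p : PrimeSpectrum k, IsMonoform (residueModule k n m hm p.asIdeal),
      ∃ f : Topology.WithUpperSet (PrimeSpectrum k) →
          ASpec (ModuleCat.{u} (FreeAlgebra k (Fin n) ⧸ varIdeal k n ^ m)),
        (∀ p : PrimeSpectrum k, f (Topology.WithUpperSet.toUpperSet p) =
          atom (residueModule k n m hm p.asIdeal) (hH p)) ∧
        IsHomeomorph f ∧
        ∃ e : Topology.WithUpperSet (PrimeSpectrum k) ≃o
          ASpec (ModuleCat.{u} (FreeAlgebra k (Fin n) ⧸ varIdeal k n ^ m)), ⇑e = f) ∧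
    (∀ (k : Type u) [CommRing k] (V : Type v) [Quiver.{w} V] [Fintype V] (m : ℕ) (hm : 1 ≤ m),
      ∃ hH : ∀ (i : V) (p : PrimeSpectrum k),
        IsMonoform (PathAlgebra.vertexModule (V := V) m hm p.asIdeal i),
      ∃ f : (Σ _ : V, Topology.WithUpperSet (PrimeSpectrum k)) →
          ASpec (ModuleCat.{max u v w} (PathAlgebra k V ⧸ PathAlgebra.arrowIdeal k V ^ m)),
        (∀ (i : V) (p : PrimeSpectrum k), f ⟨i, Topology.WithUpperSet.toUpperSet p⟩ =
          atom (PathAlgebra.vertexModule m hm p.asIdeal i) (hH i p)) ∧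
        IsHomeomorph f ∧
        ∃ e : (Σ _ : V, Topology.WithUpperSet (PrimeSpectrum k)) ≃o
          ASpec (ModuleCat.{max u v w} (PathAlgebra k V ⧸ PathAlgebra.arrowIdeal k V ^ m)),
          ⇑e = f) := by
  refine ⟨fun k _ n m _ hm => ?_, fun k _ V _ _ m hm => ?_⟩
  · exact exists_isHomeomorph_residueModule k n m hm
  · exact PathAlgebra.exists_isHomeomorph_vertexModule m hm
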